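/- **Language.** Let $\Phi$ be a set of primitive propositions and $n\ge 0$ a number of agents. $\mathcal L^{K,\hookrightarrow}_n(\Phi)$ is the set of formulas built from the elements of $\Phi$ and $\top$ with $\neg,\land,\hookrightarrow,K_1,\dots,K_n$; $\mathcal L^K_n(\Phi)$ is its part without $\hookrightarrow$, and $\mathcal L^{\hookrightarrow}(\Phi)$ its part without $K_1,\dots,K_n$. Write $\varphi\lor\psi$ for $\neg(\neg\varphi\land\neg\psi)$, $\varphi\rightleftharpoons\psi$ for $(\varphi\hookrightarrow\psi)\land(\psi\hookrightarrow\varphi)$, $\varphi=1$ for $\neg(\varphi\hookrightarrow\neg\top)$, $\varphi=0$ for $\neg(\neg\varphi\hookrightarrow\neg\top)$, and $\varphi=\frac12$ for $(\varphi\hookrightarrow\neg\top)\land(\neg\varphi\hookrightarrow\neg\top)$. Let $\Phi_\varphi$ be the set of primitive propositions occurring in $\varphi$; an empty disjunction is $\neg\top$. **Structures.** An HMS structure $M$ for $n$ agents over $\Phi$ consists of a set of states $\Sigma=\bigcup_{\Psi\subseteq\Phi}S_\Psi$, maps $\mathcal K_i:\Sigma\to2^\Sigma$ ($1\le i\le n$),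 an interpretation $\pi:\Sigma\times\Phi\to\{0,\frac12,1\}$ such that for $s\in S_\Psi$ we have $\pi(s,p)\ne\frac12$ iff $p\in\Psi$, and, for $\Psi\subseteq\Psi'$, surjections $\rho_{\Psi',\Psi}:S_{\Psi'}\to S_\Psi$ such that $\rho_{\Psi_2,\Psi_1}(\rho_{\Psi_3,\Psi_2}(s))=\rho_{\Psi_3,\Psi_1}(s)$ for $\Psi_1\subseteq\Psi_2\subseteq\Psi_3$ and $s\in S_{\Psi_3}$, and $\pi(\rho_{\Psi',\Psi}(s),p)=\pi(s,p)$ for $s\in S_{\Psi'}$ and $p\in\Psi$. For $B\subseteq S_\Psi$ let $B^\uparrow=\bigcup_{\Psi'\supseteq\Psi}\rho_{\Psi',\Psi}^{-1}(B)$. For $C\subseteq\{r,t,e\}$, $\mathcal H^C_n(\Phi)$ is the class of HMS structures such that for all agents $i$: * (confinedness) if $s\in S_\Psi$ then $\mathcal K_i(s)\subseteq S_{\Psi'}$ for some $\Psi'\subseteq\Psi$; * (projections preserve knowledge) if $\Psi_1\subseteq\Psi_2\subseteq\Psi_3$, $s\in S_{\Psi_3}$ and $\mathcal K_i(s)\subseteq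 S_{\Psi_2}$, then $\rho_{\Psi_2,\Psi_1}(\mathcal K_i(s))=\mathcal K_i(\rho_{\Psi_3,\Psi_1}(s))$; * (projections preserve ignorance) if $s\in S_{\Psi'}$ and $\Psi\subseteq\Psi'$, then $\mathcal K_i(s)^\uparrow\subseteq\mathcal K_i(\rho_{\Psi',\Psi}(s))^\uparrow$; * if $r\in C$: $s\in\mathcal K_i(s)^\uparrow$ for all $s$; * if $t\in C$: $s'\in\mathcal K_i(s)$ implies $\mathcal K_i(s')\subseteq\mathcal K_i(s)$; * if $e\in C$: $s'\in\mathcal K_i(s)$ implies $\mathcal K_i(s')\supseteq\mathcal K_i(s)$. **Semantics.** Each formula is true, false or undefined at a state $s$ ("defined" means true or false). $\top$ is true; $p\in\Phi$ is true if $\pi(s,p)=1$, false if $\pi(s,p)=0$; $\neg\varphi$ is true (false) if $\varphi$ is false (true). $\varphi\land\psi$ is true if both are true, and false if both are defined and at least one is false. $\varphi\hookrightarrow\psi$ is true if $\varphi$ and $\psi$ are true, or $\varphi$ is undefined, or $\varphi$ is false and $\psi$ is defined; it is false if $\varphi$ is true and $\psi$ is false. $K_i\varphi$ is defined iff $\varphi$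 is defined at $s$, and then it is true iff $\varphi$ is true at all $t\in\mathcal K_i(s)$. In all other cases the formula is undefined. A formula is strongly valid in $\mathcal H^C_n(\Phi)$ if it is true at every state of every structure in that class. **Axiom system.** $\mathrm{AX}^{K,\hookrightarrow}_n$ has the axioms * Prop$'$: all substitution instances in $\mathcal L^{K,\hookrightarrow}_n(\Phi)$ of strongly valid propositional formulas, i.e. of those formulas of $\mathcal L^{\hookrightarrow}(X)$ that are true at every state of every structure in $\mathcal H^{\emptyset}_n(X)$, where $X$ is a countably infinite set of propositional letters; * K$'$: $(K_i\varphi\land K_i(\varphi\hookrightarrow\psi))\hookrightarrow K_i\psi$; * B1: $(K_i\varphi)=\frac12\rightleftharpoons\varphi=\frac12$; * B2: $((\varphi=0\lor\varphi=1)\land K_i(\varphi=1))\hookrightarrow(K_i\varphi)=1$; * Conf1: $(\varphi=\frac12)\hookrightarrow K_i(\varphi=\frac12)$ for $\varphi\in\mathcal L^K_n(\Phi)$; * Conf2: $\neg K_i(\varphi=\frac12)\hookrightarrow K_i((\varphi\lor\neg\varphi)=1)$; and the rules MP$'$ (from $\varphi$ and $\varphi\hookrightarrow\psi$ infer $\psi$),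 Gen (from $\varphi$ infer $K_i\varphi$), and R1 (from $\varphi=1$ infer $\varphi$). The optional axioms are * T$'$: $K_i\varphi\hookrightarrow\varphi\lor\bigvee_{p\in\Phi_\varphi}K_i(p=\frac12)$; * 4$'$: $K_i\varphi\hookrightarrow K_iK_i\varphi$; * 5$'$: $\neg K_i\neg K_i\varphi\hookrightarrow(K_i\varphi)\lor K_i(\varphi=\frac12)$. **Theorem.** Let $\mathcal C$ be a (possibly empty) subset of $\{\mathrm T',4',5'\}$ and let $C$ be the corresponding subset of $\{r,t,e\}$ (T$'$, 4$'$, 5$'$ corresponding to $r,t,e$). Then $\mathrm{AX}^{K,\hookrightarrow}_n\cup\mathcal C$ is a sound and complete axiomatization of $\mathcal L^{K,\hookrightarrow}_n(\Phi)$ with respect to $\mathcal H^C_n(\Phi)$: a formula $\varphi\in\mathcal L^{K,\hookrightarrow}_n(\Phi)$ is provable in $\mathrm{AX}^{K,\hookrightarrow}_n\cup\mathcal C$ if and only if it is strongly valid in $\mathcal H^C_n(\Phi)$. -/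

import Mathlib

namespace HMS

/-- The three truth values `0`, `1/2` (undefined) and `1`. -/
inductive TruthVal where
  | zero
  | half
  | one
  deriving DecidableEq

/-- Formulas built from primitive propositions in `Φ` and `⊤` by negation, conjunction,
the nonstandard implication (`imp`, written `↪` in comments) and `K₁, …, Kₙ`. -/
inductive Formula (n : ℕ) (Φ : Type*) where
  | atom (p : Φ)
  | top
  | neg (φ : Formula n Φ)
  | and (φ ψ : Formula n Φ)
  | imp (φ ψ : Formula n Φ)
  | know (i : Fin n) (φ : Formula n Φ)

namespace Formula

variable {n : ℕ} {Φ Φ' : Type*}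

/-- `φ ∨ ψ := ¬(¬φ ∧ ¬ψ)`. -/
def or (φ ψ : Formula n Φ) : Formula n Φ := neg (and (neg φ) (neg ψ))

/-- `φ ⇌ ψ := (φ ↪ ψ) ∧ (ψ ↪ φ)`. -/
def iff (φ ψ : Formula n Φ) : Formula n Φ := and (imp φ ψ) (imp ψ φ)

/-- `φ = 1 := ¬(φ ↪ ¬⊤)`. -/
def eqOne (φ : Formula n Φ) : Formula n Φ := neg (imp φ (neg top))

/-- `φ = 0 := ¬(¬φ ↪ ¬⊤)`. -/
def eqZero (φ : Formula n Φ) : Formula n Φ := neg (imp (neg φ) (neg top))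

/-- `φ = 1/2 := (φ ↪ ¬⊤) ∧ (¬φ ↪ ¬⊤)`. -/
def eqHalf (φ : Formula n Φ) : Formula n Φ :=
  and (imp φ (neg top)) (imp (neg φ) (neg top))

/-- Finite disjunction; the empty disjunction is `¬⊤`. -/
def bigOr : List (Formula n Φ) → Formula n Φ
  | [] => neg top
  | φ :: l => or φ (bigOr l)

/-- The set `Φ_φ` of primitive propositions that occur in `φ`. -/
def atoms : Formula n Φ → Set Φ
  | atom p => {p}
  | top => ∅
  | neg φ => atoms φ
  | and φ ψ => atoms φ ∪ atoms ψ
  | imp φ ψ => atoms φ ∪ atoms ψ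
  | know _ φ => atoms φ

/-- Formulas without `K₁, …, Kₙ`: the propositional fragment. -/
def IsPropositional : Formula n Φ → Prop
  | atom _ => True
  | top => True
  | neg φ => IsPropositional φ
  | and φ ψ => IsPropositional φ ∧ IsPropositional ψ
  | imp φ ψ => IsPropositional φ ∧ IsPropositional ψ
  | know _ _ => False

/-- Formulas without `↪`: the language of standard epistemic logic. -/
def IsImpFree : Formula n Φ → Prop
  | atom _ => True
  | top => True
  | neg φ => IsImpFree φ
  | and φ ψ => IsImpFree φ ∧ IsImpFree ψ
  | imp _ _ => False
  | know _ φ => IsImpFree φ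

/-- Simultaneous substitution of formulas for primitive propositions. -/
def subst (σ : Φ → Formula n Φ') : Formula n Φ → Formula n Φ'
  | atom p => σ p
  | top => top
  | neg φ => neg (subst σ φ)
  | and φ ψ => and (subst σ φ) (subst σ ψ)
  | imp φ ψ => imp (subst σ φ) (subst σ ψ)
  | know i φ => know i (subst σ φ)

end Formula

/-- An HMS structure for `n` agents over `Φ`. The set of all states is `State`, covered by the
sets `S Ψ` (which are disjoint by `π_defined`); `ρ Ψ' Ψ` is the projection of `S Ψ'` onto `S Ψ`,
and only its values on `S Ψ'` for `Ψ ⊆ Ψ'` matter. -/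
structure Structure (n : ℕ) (Φ : Type*) where
  State : Type*
  S : Set Φ → Set State
  cover : ∀ s, ∃ Ψ, s ∈ S Ψ
  K : Fin n → State → Set State
  π : State → Φ → TruthVal
  π_defined : ∀ Ψ, ∀ s ∈ S Ψ, ∀ p, π s p ≠ TruthVal.half ↔ p ∈ Ψ
  ρ : Set Φ → Set Φ → State → State
  ρ_mapsTo : ∀ Ψ Ψ', Ψ ⊆ Ψ' → Set.MapsTo (ρ Ψ' Ψ) (S Ψ') (S Ψ)
  ρ_surjOn : ∀ Ψ Ψ', Ψ ⊆ Ψ' → Set.SurjOn (ρ Ψ' Ψ) (S Ψ') (S Ψ)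
  ρ_comp : ∀ Ψ₁ Ψ₂ Ψ₃, Ψ₁ ⊆ Ψ₂ → Ψ₂ ⊆ Ψ₃ → ∀ s ∈ S Ψ₃, ρ Ψ₂ Ψ₁ (ρ Ψ₃ Ψ₂ s) = ρ Ψ₃ Ψ₁ s
  /-- `ρ Ψ' Ψ s` describes `s` in the vocabulary `Ψ`. -/
  ρ_π : ∀ Ψ Ψ', Ψ ⊆ Ψ' → ∀ s ∈ S Ψ', ∀ p ∈ Ψ, π (ρ Ψ' Ψ s) p = π s p

namespace Structure

variable {n : ℕ} {Φ : Type*}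

/-- For `B ⊆ S Ψ`, the set `B↑` of all `t` in some `S Ψ'` with `Ψ ⊆ Ψ'` whose projection to
`S Ψ` lies in `B`. (`Ψ` is determined by `B` if `B` is nonempty, and `∅↑ = ∅`.) -/
def up (M : Structure n Φ) (B : Set M.State) : Set M.State :=
  {t | ∃ Ψ Ψ', B ⊆ M.S Ψ ∧ Ψ ⊆ Ψ' ∧ t ∈ M.S Ψ' ∧ M.ρ Ψ' Ψ t ∈ B}

def Confined (M : Structure n Φ) : Prop :=
  ∀ i Ψ, ∀ s ∈ M.S Ψ, ∃ Ψ' ⊆ Ψ, M.K i s ⊆ M.S Ψ'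

def GeneralizedReflexive (M : Structure n Φ) : Prop :=
  ∀ i s, s ∈ M.up (M.K i s)

/-- Stationarity, part (a). -/
def StationaryA (M : Structure n Φ) : Prop :=
  ∀ i s, ∀ s' ∈ M.K i s, M.K i s' ⊆ M.K i s

/-- Stationarity, part (b). -/
def StationaryB (M : Structure n Φ) : Prop :=
  ∀ i s, ∀ s' ∈ M.K i s, M.K i s ⊆ M.K i s'

def ProjectionsPreserveKnowledge (M : Structure n Φ) : Prop :=
  ∀ i Ψ₁ Ψ₂ Ψ₃, Ψ₁ ⊆ Ψ₂ → Ψ₂ ⊆ Ψ₃ → ∀ s ∈ M.S Ψ₃, M.K i s ⊆ M.S Ψ₂ →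
    M.ρ Ψ₂ Ψ₁ '' M.K i s = M.K i (M.ρ Ψ₃ Ψ₁ s)

def ProjectionsPreserveIgnorance (M : Structure n Φ) : Prop :=
  ∀ i Ψ Ψ', Ψ ⊆ Ψ' → ∀ s ∈ M.S Ψ', M.up (M.K i s) ⊆ M.up (M.K i (M.ρ Ψ' Ψ s))

mutual

/-- `(M, s) ⊨ φ`: the formula `φ` is true at `s`. -/
def Holds (M : Structure n Φ) : Formula n Φ → M.State → Prop
  | .atom p, s => M.π s p = TruthVal.one
  | .top, _ => True
  | .neg φ, s => Fails M φ s
  | .and φ ψ, s => Holds M φ s ∧ Holds M ψ s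
  | .imp φ ψ, s =>
      (Holds M φ s ∧ Holds M ψ s) ∨ (¬ Holds M φ s ∧ ¬ Fails M φ s) ∨
        (Fails M φ s ∧ (Holds M ψ s ∨ Fails M ψ s))
  | .know i φ, s => (Holds M φ s ∨ Fails M φ s) ∧ ∀ t ∈ M.K i s, Holds M φ t

/-- `(M, s) ⊨ ¬φ`: the formula `φ` is false at `s`. -/
def Fails (M : Structure n Φ) : Formula n Φ → M.State → Prop
  | .atom p, s => M.π s p = TruthVal.zero
  | .top, _ => False
  | .neg φ, s => Holds M φ s
  | .and φ ψ, s =>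
      (Fails M φ s ∧ Holds M ψ s) ∨ (Holds M φ s ∧ Fails M ψ s) ∨ (Fails M φ s ∧ Fails M ψ s)
  | .imp φ ψ, s => Holds M φ s ∧ Fails M ψ s
  | .know i φ, s =>
      ¬ ((Holds M φ s ∨ Fails M φ s) ∧ ∀ t ∈ M.K i s, Holds M φ t) ∧
        (Holds M φ s ∨ Fails M φ s)

end

end Structure

/-- Names for the three optional conditions: generalized reflexivity and the two parts of
stationarity, matched with the axioms T′, 4′ and 5′. -/
inductive Cond where
  | r
  | t
  | e

variable {n : ℕ} {Φ : Type*}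

/-- Membership of `M` in the class of HMS structures given by `C ⊆ {r, t, e}`. -/
structure InClass (C : Set Cond) (M : Structure n Φ) : Prop where
  confined : M.Confined
  knowledge : M.ProjectionsPreserveKnowledge
  ignorance : M.ProjectionsPreserveIgnorance
  r : Cond.r ∈ C → M.GeneralizedReflexive
  t : Cond.t ∈ C → M.StationaryA
  e : Cond.e ∈ C → M.StationaryB

/-- Strong validity: truth at every state of every structure of the class. -/
def StronglyValid.{u} {Φ : Type u} (C : Set Cond) (φ : Formula n Φ) : Prop :=
  ∀ M : Structure.{u, u} n Φ, InClass C M → ∀ s : M.State, M.Holds φ s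

/-- The axioms. In `prop` the schematic propositional formula `α` is written in a countable
supply of letters, whatever the size of `Φ`; in `T'` the list `l` enumerates the primitive
propositions that occur in `φ`. -/
inductive IsAxiom (C : Set Cond) : Formula n Φ → Prop
  | prop (α : Formula n ℕ) (hα : α.IsPropositional) (hv : StronglyValid ∅ α)
      (σ : ℕ → Formula n Φ) : IsAxiom C (α.subst σ)
  | K' (i : Fin n) (φ ψ : Formula n Φ) :
      IsAxiom C (.imp (.and (.know i φ) (.know i (.imp φ ψ))) (.know i ψ))
  | B1 (i : Fin n) (φ : Formula n Φ) :
      IsAxiom C (.iff (.eqHalf (.know i φ)) (.eqHalf φ))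
  | B2 (i : Fin n) (φ : Formula n Φ) :
      IsAxiom C (.imp (.and (.or (.eqZero φ) (.eqOne φ)) (.know i (.eqOne φ)))
        (.eqOne (.know i φ)))
  | Conf1 (i : Fin n) (φ : Formula n Φ) (hφ : φ.IsImpFree) :
      IsAxiom C (.imp (.eqHalf φ) (.know i (.eqHalf φ)))
  | Conf2 (i : Fin n) (φ : Formula n Φ) :
      IsAxiom C (.imp (.neg (.know i (.eqHalf φ))) (.know i (.eqOne (.or φ (.neg φ)))))
  | T' (h : Cond.r ∈ C) (i : Fin n) (φ : Formula n Φ) (l : List Φ)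
      (hl : ∀ p, p ∈ l ↔ p ∈ φ.atoms) :
      IsAxiom C (.imp (.know i φ)
        (.or φ (.bigOr (l.map fun p => .know i (.eqHalf (.atom p))))))
  | four' (h : Cond.t ∈ C) (i : Fin n) (φ : Formula n Φ) :
      IsAxiom C (.imp (.know i φ) (.know i (.know i φ)))
  | five' (h : Cond.e ∈ C) (i : Fin n) (φ : Formula n Φ) :
      IsAxiom C (.imp (.neg (.know i (.neg (.know i φ))))
        (.or (.know i φ) (.know i (.eqHalf φ))))

/-- Provability: the closure of the axioms under modus ponens for `↪`, generalization, and the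
propositional rule R1 (from `φ = 1` infer `φ`). -/
inductive Provable (C : Set Cond) : Formula n Φ → Prop
  | ax {φ : Formula n Φ} (h : IsAxiom C φ) : Provable C φ
  | mp {φ ψ : Formula n Φ} (h₁ : Provable C φ) (h₂ : Provable C (.imp φ ψ)) : Provable C ψ
  | gen {φ : Formula n Φ} (i : Fin n) (h : Provable C φ) : Provable C (.know i φ)
  | R1 {φ : Formula n Φ} (h : Provable C φ.eqOne) : Provable C φ

end HMS

-- Soundness is checked on three-valued truth values. Definedness at a state depends only on its
-- vocabulary, and an information set lies over one vocabulary, contained in that of the state; this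
-- yields Conf1, Conf2 and the undefined case of 5′. For T′, truth must pass from the information
-- set back to the state: by `InClass.val_ρ`, a projection that loses no letter of a formula keeps
-- its value.
--
-- Completeness uses a canonical structure. In place of maximal consistent sets there are worlds,
-- three-valued homomorphisms that make all provable formulas true; compactness of a product of
-- finite spaces supplies them (`IsTheory.exists_world`). Accessibility means satisfying every φ
-- with K_i(φ=1) true; the form φ=1 is used because it is always defined. By Conf1 and Conf2, the
-- worlds accessible from w define exactly the letters in `w.aware i`.
--
-- A state pairs a world with an arbitrary vocabulary, so projections change only the second
-- component and their laws are immediate. An information set then has to contain worlds richer than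
-- its vocabulary: `World.info` takes all extensions of accessible worlds, which admits w itself
-- under T′, and its bound on awareness is what 5′ needs. The truth lemma `canonical_val`
-- accordingly evaluates the state (x, v.dom) by v whenever x extends v. Its step for K_i rests on
-- the back-and-forth pair `World.Extends.exists_acc_restrict` and
-- `World.Extends.exists_acc_extend`.

namespace HMS

universe u v

variable {n : ℕ} {Φ : Type u}

-- Three-valued propositional semantics

namespace TruthVal

/-- Truth table of negation. -/
def not : TruthVal → TruthVal
  | zero => one
  | half => half
  | one => zero

/-- Truth table of conjunction. -/
def and : TruthVal → TruthVal → TruthVal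
  | half, _ => half
  | _, half => half
  | one, one => one
  | _, _ => zero

/-- Truth table of the nonstandard implication. -/
def imp : TruthVal → TruthVal → TruthVal
  | half, _ => one
  | one, b => b
  | zero, half => half
  | zero, _ => one

end TruthVal

/-- Valuations that respect the truth tables of the propositional connectives. -/
structure IsHom (w : Formula n Φ → TruthVal) : Prop where
  top : w .top = .one
  neg : ∀ φ, w φ.neg = (w φ).not
  and : ∀ φ ψ, w (φ.and ψ) = (w φ).and (w ψ)
  imp : ∀ φ ψ, w (φ.imp ψ) = (w φ).imp (w ψ)

namespace IsHom

variable {w : Formula n Φ → TruthVal} (h : IsHom w)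
include h

theorem eqOne (φ : Formula n Φ) : w φ.eqOne = if w φ = .one then .one else .zero := by
  rw [Formula.eqOne, h.neg, h.imp, h.neg, h.top]
  cases w φ <;> rfl

theorem eqZero (φ : Formula n Φ) : w φ.eqZero = if w φ = .zero then .one else .zero := by
  rw [Formula.eqZero, h.neg, h.imp, h.neg, h.neg, h.top]
  cases w φ <;> rfl

theorem eqHalf (φ : Formula n Φ) : w φ.eqHalf = if w φ = .half then .one else .zero := by
  rw [Formula.eqHalf, h.and, h.imp, h.imp, h.neg, h.neg, h.top]
  cases w φ <;> rfl

theorem or (φ ψ : Formula n Φ) : w (φ.or ψ) = ((w φ).not.and (w ψ).not).not := by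
  rw [Formula.or, h.neg, h.and, h.neg, h.neg]

theorem iff (φ ψ : Formula n Φ) :
    w (φ.iff ψ) = ((w φ).imp (w ψ)).and ((w ψ).imp (w φ)) := by
  rw [Formula.iff, h.and, h.imp, h.imp]

theorem bigOr_ne_half {l : List (Formula n Φ)} (hl : ∀ φ ∈ l, w φ ≠ .half) :
    w (.bigOr l) ≠ .half := by
  induction l with
  | nil => simp [Formula.bigOr, h.neg, h.top, TruthVal.not]
  | cons φ l ih =>
    have h₁ := hl φ (by simp)
    have h₂ := ih fun ψ hψ => hl ψ (by simp [hψ])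
    rw [Formula.bigOr, h.or]
    revert h₁ h₂
    cases w φ <;> cases w (.bigOr l) <;> simp [TruthVal.not, TruthVal.and]

theorem bigOr_eq_one {l : List (Formula n Φ)} (hl : ∀ φ ∈ l, w φ ≠ .half) :
    w (.bigOr l) = .one ↔ ∃ φ ∈ l, w φ = .one := by
  induction l with
  | nil => simp [Formula.bigOr, h.neg, h.top, TruthVal.not]
  | cons φ l ih =>
    have h₁ := hl φ (by simp)
    have h₂ := h.bigOr_ne_half fun ψ hψ => hl ψ (List.mem_cons_of_mem _ hψ)
    have h₃ := ih fun ψ hψ => hl ψ (by simp [hψ])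
    rw [Formula.bigOr, h.or]
    simp only [List.mem_cons, exists_eq_or_imp, ← h₃]
    revert h₁ h₂
    cases w φ <;> cases w (.bigOr l) <;> simp [TruthVal.not, TruthVal.and]

end IsHom

/-- Homomorphisms that agree on the letters agree on propositional formulas. -/
theorem IsHom.eq_of_atoms {w w' : Formula n Φ → TruthVal} (h : IsHom w) (h' : IsHom w')
    (hp : ∀ p, w (.atom p) = w' (.atom p)) :
    ∀ φ : Formula n Φ, φ.IsPropositional → w φ = w' φ
  | .atom p, _ => hp p
  | .top, _ => by rw [h.top, h'.top]
  | .neg φ, hφ => by rw [h.neg, h'.neg, IsHom.eq_of_atoms h h' hp φ hφ]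
  | .and φ ψ, hφ => by
    rw [h.and, h'.and, IsHom.eq_of_atoms h h' hp φ hφ.1, IsHom.eq_of_atoms h h' hp ψ hφ.2]
  | .imp φ ψ, hφ => by
    rw [h.imp, h'.imp, IsHom.eq_of_atoms h h' hp φ hφ.1, IsHom.eq_of_atoms h h' hp ψ hφ.2]

theorem TruthVal.imp_eq_one {a b : TruthVal} (h₁ : a = .one → b = .one)
    (h₂ : a ≠ .half → b ≠ .half) : a.imp b = .one := by
  revert h₁ h₂
  cases a <;> cases b <;> simp [TruthVal.imp]

-- Truth values and definedness in HMS structures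

namespace Structure

theorem not_fails_of_holds (M : Structure.{u, v} n Φ) (φ : Formula n Φ) (s : M.State) :
    M.Holds φ s → ¬ M.Fails φ s := by
  induction φ with
  | atom p => simp only [Holds, Fails]; rintro h; rw [h]; simp
  | top => simp [Fails]
  | neg φ ih => simp only [Holds, Fails]; tauto
  | and φ ψ ih₁ ih₂ => simp only [Holds, Fails]; tauto
  | imp φ ψ ih₁ ih₂ => simp only [Holds, Fails]; tauto
  | know i φ ih => simp only [Holds, Fails]; tauto

open Classical in
/-- The truth value of a formula at a state. -/
noncomputable def val (M : Structure.{u, v} n Φ) (s : M.State) (φ : Formula n Φ) : TruthVal :=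
  if M.Holds φ s then .one else if M.Fails φ s then .zero else .half

variable (M : Structure.{u, v} n Φ)

theorem val_eq_one {s : M.State} {φ : Formula n Φ} : M.val s φ = .one ↔ M.Holds φ s := by
  unfold val; split_ifs <;> simp [*]

theorem val_eq_zero {s : M.State} {φ : Formula n Φ} : M.val s φ = .zero ↔ M.Fails φ s := by
  unfold val
  split_ifs with h₁ h₂
  · simpa using M.not_fails_of_holds _ _ h₁
  · simpa using h₂
  · simpa using h₂

theorem val_ne_half {s : M.State} {φ : Formula n Φ} :
    M.val s φ ≠ .half ↔ M.Holds φ s ∨ M.Fails φ s := by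
  unfold val; split_ifs <;> simp [*]

theorem val_eq_half {s : M.State} {φ : Formula n Φ} :
    M.val s φ = .half ↔ ¬ M.Holds φ s ∧ ¬ M.Fails φ s := by
  rw [← not_iff_not, ← ne_eq, val_ne_half]; tauto

theorem isHom_val (s : M.State) : IsHom (M.val s) where
  top := M.val_eq_one.2 (by simp [Holds])
  neg φ := by
    cases h : M.val s φ
    · exact M.val_eq_one.2 (by rw [Holds]; exact M.val_eq_zero.1 h)
    · exact M.val_eq_half.2 (by rw [Holds, Fails]; exact (M.val_eq_half.1 h).symm)
    · exact M.val_eq_zero.2 (by rw [Fails]; exact M.val_eq_one.1 h)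
  and φ ψ := by
    cases h : M.val s φ <;> cases h' : M.val s ψ <;>
      simp only [TruthVal.and, val_eq_one, val_eq_zero, val_eq_half, Holds, Fails] at * <;>
      tauto
  imp φ ψ := by
    cases h : M.val s φ <;> cases h' : M.val s ψ <;>
      simp only [TruthVal.imp, val_eq_one, val_eq_zero, val_eq_half, Holds, Fails] at * <;>
      tauto

theorem val_know_eq_half {s : M.State} {i : Fin n} {φ : Formula n Φ} :
    M.val s (.know i φ) = .half ↔ M.val s φ = .half := by
  rw [val_eq_half, val_eq_half, Holds, Fails]; tauto

theorem val_know_eq_one {s : M.State} {i : Fin n} {φ : Formula n Φ} :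
    M.val s (.know i φ) = .one ↔ M.val s φ ≠ .half ∧ ∀ t ∈ M.K i s, M.val t φ = .one := by
  rw [val_eq_one, val_ne_half, Holds]; simp only [val_eq_one]

variable {M}

theorem val_atom_ne_half {Ψ : Set Φ} {s : M.State} (hs : s ∈ M.S Ψ) {p : Φ} :
    M.val s (.atom p) ≠ .half ↔ p ∈ Ψ := by
  rw [← M.π_defined Ψ s hs, val_ne_half, Holds, Fails]
  cases M.π s p <;> simp

theorem val_atom (s : M.State) (p : Φ) : M.val s (.atom p) = M.π s p := by
  have h₁ := M.val_eq_one (s := s) (φ := .atom p)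
  have h₂ := M.val_eq_zero (s := s) (φ := .atom p)
  rw [Holds] at h₁
  rw [Fails] at h₂
  revert h₁ h₂
  cases M.π s p <;> cases M.val s (.atom p) <;> simp

theorem S_unique {Ψ Ψ' : Set Φ} {s : M.State} (hs : s ∈ M.S Ψ) (hs' : s ∈ M.S Ψ') : Ψ = Ψ' := by
  ext p
  rw [← val_atom_ne_half hs, ← val_atom_ne_half hs']

/-- Whether a formula is defined at a state depends on its vocabulary only. -/
theorem val_eq_half_congr {Ψ Ψ' : Set Φ} {s t : M.State} (hs : s ∈ M.S Ψ) (ht : t ∈ M.S Ψ')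
    (φ : Formula n Φ) (h : ∀ p ∈ φ.atoms, p ∈ Ψ ↔ p ∈ Ψ') :
    M.val s φ = .half ↔ M.val t φ = .half := by
  induction φ with
  | atom p =>
    rw [← not_iff_not, ← ne_eq, ← ne_eq, val_atom_ne_half hs, val_atom_ne_half ht]
    exact h p rfl
  | top => simp [(M.isHom_val _).top]
  | neg φ ih =>
    have := ih h
    rw [(M.isHom_val _).neg, (M.isHom_val _).neg]
    revert this
    cases M.val s φ <;> cases M.val t φ <;> simp [TruthVal.not]
  | and φ ψ ih₁ ih₂ =>
    have h₁ := ih₁ fun p hp => h p (.inl hp)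
    have h₂ := ih₂ fun p hp => h p (.inr hp)
    rw [(M.isHom_val _).and, (M.isHom_val _).and]
    revert h₁ h₂
    cases M.val s φ <;> cases M.val t φ <;> cases M.val s ψ <;> cases M.val t ψ <;>
      simp [TruthVal.and]
  | imp φ ψ ih₁ ih₂ =>
    have h₁ := ih₁ fun p hp => h p (.inl hp)
    have h₂ := ih₂ fun p hp => h p (.inr hp)
    rw [(M.isHom_val _).imp, (M.isHom_val _).imp]
    revert h₁ h₂
    cases M.val s φ <;> cases M.val t φ <;> cases M.val s ψ <;> cases M.val t ψ <;>
      simp [TruthVal.imp]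
  | know i φ ih => rw [val_know_eq_half, val_know_eq_half]; exact ih h

/-- Without ↪, shrinking the vocabulary can only destroy definedness. The restriction is essential:
φ ↪ ψ becomes true once φ is undefined. -/
theorem val_eq_half_of_isImpFree {Ψ Ψ' : Set Φ} {s t : M.State} (hs : s ∈ M.S Ψ)
    (ht : t ∈ M.S Ψ') (hΨ : Ψ' ⊆ Ψ) (φ : Formula n Φ) (hφ : φ.IsImpFree)
    (h : M.val s φ = .half) : M.val t φ = .half := by
  induction φ with
  | atom p =>
    contrapose! h
    rw [val_atom_ne_half ht] at h
    exact (val_atom_ne_half hs).2 (hΨ h)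
  | top => simp [(M.isHom_val _).top] at h
  | neg φ ih =>
    have := ih hφ
    rw [(M.isHom_val _).neg] at h ⊢
    revert this h
    cases M.val s φ <;> cases M.val t φ <;> simp [TruthVal.not]
  | and φ ψ ih₁ ih₂ =>
    have h₁ := ih₁ hφ.1
    have h₂ := ih₂ hφ.2
    rw [(M.isHom_val _).and] at h ⊢
    revert h₁ h₂ h
    cases M.val s φ <;> cases M.val t φ <;> cases M.val s ψ <;> cases M.val t ψ <;>
      simp [TruthVal.and]
  | imp φ ψ _ _ => exact hφ.elim
  | know i φ ih => rw [val_know_eq_half] at h ⊢; exact ih hφ h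

theorem ρ_self {Ψ : Set Φ} {s : M.State} (hs : s ∈ M.S Ψ) : M.ρ Ψ Ψ s = s := by
  obtain ⟨t, ht, rfl⟩ := M.ρ_surjOn Ψ Ψ subset_rfl hs
  exact M.ρ_comp Ψ Ψ Ψ subset_rfl subset_rfl t ht

theorem subset_up {B : Set M.State} {Ψ : Set Φ} (hB : B ⊆ M.S Ψ) : B ⊆ M.up B := fun t ht =>
  ⟨Ψ, Ψ, hB, subset_rfl, hB ht, by rwa [ρ_self (hB ht)]⟩

theorem subset_of_mem_up {B : Set M.State} {Ψ Ψ' : Set Φ} (hB : B ⊆ M.S Ψ) {t : M.State}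
    (ht : t ∈ M.S Ψ') (h : t ∈ M.up B) : Ψ ⊆ Ψ' ∧ M.ρ Ψ' Ψ t ∈ B := by
  obtain ⟨Ψ₁, Ψ₂, hB', hsub, ht', hρ⟩ := h
  obtain rfl := S_unique ht ht'
  obtain rfl := S_unique (hB hρ) (hB' hρ)
  exact ⟨hsub, hρ⟩

end Structure

-- Projections and information sets

open Structure

variable {C : Set Cond} {M : Structure.{u, v} n Φ}

/-- The information set at a projected state. -/
theorem InClass.K_ρ (hM : InClass C M) (i : Fin n) {Ψ Ψ' Ψ'' : Set Φ} (h' : Ψ' ⊆ Ψ)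
    (h'' : Ψ'' ⊆ Ψ) {s : M.State} (hs : s ∈ M.S Ψ) (hK : M.K i s ⊆ M.S Ψ'') :
    M.K i (M.ρ Ψ Ψ' s) = M.ρ Ψ'' (Ψ' ∩ Ψ'') '' M.K i s := by
  set s' := M.ρ Ψ Ψ' s with hs'_def
  have hs' : s' ∈ M.S Ψ' := M.ρ_mapsTo _ _ h' hs
  have hle : Ψ' ∩ Ψ'' ⊆ Ψ' := Set.inter_subset_left
  have e₁ := hM.knowledge i _ _ _ (Set.inter_subset_right : Ψ' ∩ Ψ'' ⊆ Ψ'') h'' s hs hK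
  rw [← M.ρ_comp _ _ _ hle h' s hs, ← hs'_def] at e₁
  have hK₀ : M.K i (M.ρ Ψ' (Ψ' ∩ Ψ'') s') ⊆ M.S (Ψ' ∩ Ψ'') := by
    rw [← e₁]
    rintro _ ⟨t, ht, rfl⟩
    exact M.ρ_mapsTo _ _ Set.inter_subset_right (hK ht)
  -- Once the vocabulary of `K i s'` is known, projecting `s'` to `Ψ' ∩ Ψ''` fixes that set
  -- pointwise.
  suffices hK' : M.K i s' ⊆ M.S (Ψ' ∩ Ψ'') by
    have e₂ := hM.knowledge i _ _ _ subset_rfl hle s' hs' hK'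
    rw [e₁, ← e₂]
    ext t
    constructor
    · exact fun ht => ⟨t, ht, ρ_self (hK' ht)⟩
    · rintro ⟨t', ht', rfl⟩
      rwa [ρ_self (hK' ht')]
  intro t ht
  obtain ⟨Ψ₁, hΨ₁, hK₁⟩ := hM.confined i Ψ' s' hs'
  obtain hemp | ⟨x, hx⟩ := (M.K i s).eq_empty_or_nonempty
  · have := hM.knowledge i _ _ _ h' subset_rfl s hs (by simp [hemp])
    rw [hemp, Set.image_empty, ← hs'_def] at this
    simp [← this] at ht
  -- Preservation of ignorance bounds `Ψ₁` on both sides: passing from `s` to `s'` gives `Ψ₁ ⊆ Ψ''`,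
  -- passing from `s'` further down gives `Ψ' ∩ Ψ'' ⊆ Ψ₁`.
  · have h₁ := subset_of_mem_up hK₁ (hK hx) (hM.ignorance i _ _ h' s hs (subset_up hK hx))
    have h₂ := subset_of_mem_up hK₀ (hK₁ ht) (hM.ignorance i _ _ hle s' hs' (subset_up hK₁ ht))
    rw [← Set.Subset.antisymm (Set.subset_inter hΨ₁ h₁.1) h₂.1]
    exact hK₁ ht

/-- A projection that forgets no letter of a formula preserves its truth value. -/
theorem InClass.val_ρ (hM : InClass C M) (φ : Formula n Φ) :
    ∀ {Ψ Ψ' : Set Φ}, Ψ' ⊆ Ψ → (∀ p ∈ φ.atoms, p ∈ Ψ → p ∈ Ψ') → ∀ {s : M.State},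
      s ∈ M.S Ψ → M.val (M.ρ Ψ Ψ' s) φ = M.val s φ := by
  induction φ with
  | atom p =>
    intro Ψ Ψ' h hp s hs
    rw [val_atom, val_atom]
    by_cases hpΨ : p ∈ Ψ'
    · exact M.ρ_π _ _ h s hs p hpΨ
    · have h₁ := (M.π_defined Ψ s hs p).not.2 fun h => hpΨ (hp p rfl h)
      have h₂ := (M.π_defined Ψ' _ (M.ρ_mapsTo _ _ h hs) p).not.2 hpΨ
      rw [not_not] at h₁ h₂
      rw [h₁, h₂]
  | top => intro _ _ _ _ s _; rw [(M.isHom_val _).top, (M.isHom_val _).top]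
  | neg φ ih => intro _ _ h hp s hs; rw [(M.isHom_val _).neg, (M.isHom_val _).neg, ih h hp hs]
  | and φ ψ ih₁ ih₂ =>
    intro _ _ h hp s hs
    rw [(M.isHom_val _).and, (M.isHom_val _).and, ih₁ h (fun p hp' => hp p (.inl hp')) hs,
      ih₂ h (fun p hp' => hp p (.inr hp')) hs]
  | imp φ ψ ih₁ ih₂ =>
    intro _ _ h hp s hs
    rw [(M.isHom_val _).imp, (M.isHom_val _).imp, ih₁ h (fun p hp' => hp p (.inl hp')) hs,
      ih₂ h (fun p hp' => hp p (.inr hp')) hs]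
  | know i φ ih =>
    intro Ψ Ψ' h hp s hs
    obtain ⟨Ψ'', h'', hK⟩ := hM.confined i Ψ s hs
    have e := ih h hp hs
    have h₁ : M.val (M.ρ Ψ Ψ' s) (.know i φ) = .half ↔ M.val s (.know i φ) = .half := by
      rw [val_know_eq_half, val_know_eq_half, e]
    have h₂ : M.val (M.ρ Ψ Ψ' s) (.know i φ) = .one ↔ M.val s (.know i φ) = .one := by
      rw [val_know_eq_one, val_know_eq_one, e, hM.K_ρ i h h'' hs hK, Set.forall_mem_image]
      refine and_congr_right fun _ => forall₂_congr fun t ht => ?_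
      rw [ih Set.inter_subset_right (fun p hpφ hpt => ⟨hp p hpφ (h'' hpt), hpt⟩) (hK ht)]
    revert h₁ h₂
    cases M.val (M.ρ Ψ Ψ' s) (.know i φ) <;> cases M.val s (.know i φ) <;> simp

/-- Whether a formula is defined is the same at all states of an information set. -/
theorem InClass.val_eq_half_of_mem_K (hM : InClass C M) {i : Fin n} {s t t' : M.State}
    (ht : t ∈ M.K i s) (ht' : t' ∈ M.K i s) {φ : Formula n Φ} (h : M.val t φ = .half) :
    M.val t' φ = .half := by
  obtain ⟨Ψ, hs⟩ := M.cover s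
  obtain ⟨Ψ', -, hK⟩ := hM.confined i Ψ s hs
  exact (val_eq_half_congr (hK ht) (hK ht') φ fun _ _ => Iff.rfl).1 h

-- Soundness

open Classical in
/-- A structure over the letters `X` in which every set of letters is the vocabulary of exactly
one state, and `v` gives the truth values of the letters. -/
noncomputable def Structure.ofValuation {X : Type u} (n : ℕ) (v : X → TruthVal) :
    Structure.{u, u} n X where
  State := Set X
  S Ψ := {Ψ}
  cover s := ⟨s, rfl⟩
  K _ _ := ∅
  π s p := if p ∈ s then (if v p = .one then .one else .zero) else .half
  π_defined := by
    rintro Ψ s rfl p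
    split_ifs <;> simp [*]
  ρ _ Ψ _ := Ψ
  ρ_mapsTo _ _ _ _ _ := rfl
  ρ_surjOn := by
    rintro Ψ Ψ' - s rfl
    exact ⟨Ψ', rfl, rfl⟩
  ρ_comp _ _ _ _ _ _ _ := rfl
  ρ_π := by
    rintro Ψ Ψ' h s rfl p hp
    simp [hp, h hp]

theorem Structure.inClass_ofValuation {X : Type u} (v : X → TruthVal) :
    InClass ∅ (Structure.ofValuation n v) where
  confined _ Ψ _ _ := ⟨Ψ, subset_rfl, Set.empty_subset _⟩
  knowledge _ _ _ _ _ _ _ _ _ := Set.image_empty _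
  ignorance _ _ _ _ _ _ := subset_rfl
  r h := h.elim
  t h := h.elim
  e h := h.elim

theorem isHom_subst {X : Type v} {w : Formula n Φ → TruthVal} (hw : IsHom w)
    (σ : X → Formula n Φ) : IsHom fun α => w (α.subst σ) where
  top := hw.top
  neg _ := hw.neg _
  and _ _ := hw.and _ _
  imp _ _ := hw.imp _ _

/-- Instances of strongly valid propositional formulas are true under every homomorphism. -/
theorem StronglyValid.subst_eq_one {X : Type v} {α : Formula n X} (hα : α.IsPropositional)
    (hv : StronglyValid ∅ α) {w : Formula n Φ → TruthVal} (hw : IsHom w)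
    (σ : X → Formula n Φ) : w (α.subst σ) = .one := by
  classical
  let N := Structure.ofValuation n fun p => w (σ p)
  -- The vocabulary consists of the letters whose substitutes are defined, so letters at `s` take
  -- the values of their substitutes under `w`.
  let s : N.State := {p | w (σ p) ≠ .half}
  have h := N.val_eq_one.2 (hv N (Structure.inClass_ofValuation _) s)
  rw [(N.isHom_val s).eq_of_atoms (isHom_subst hw σ) (fun p => ?_) α hα] at h
  · exact h
  · rw [val_atom]
    simp only [N, s, Structure.ofValuation, Formula.subst, Set.mem_ofPred_eq]
    split_ifs with h₁ h₂
    · exact h₂.symm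
    · revert h₁ h₂
      cases w (σ p) <;> simp
    · exact (not_not.1 h₁).symm

theorem InClass.val_of_isAxiom (hM : InClass C M) {φ : Formula n Φ} (h : IsAxiom C φ)
    (s : M.State) : M.val s φ = .one := by
  have hh := M.isHom_val
  cases h with
  | prop α hα hv σ => exact hv.subst_eq_one hα (hh s) σ
  | K' i φ ψ =>
    rw [(hh _).imp, (hh _).and]
    have h₁ := M.val_know_eq_one (s := s) (i := i) (φ := φ)
    have h₂ := M.val_know_eq_one (s := s) (i := i) (φ := φ.imp ψ)
    have h₃ := M.val_know_eq_one (s := s) (i := i) (φ := ψ)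
    have d₁ := M.val_know_eq_half (s := s) (i := i) (φ := φ)
    have d₂ := M.val_know_eq_half (s := s) (i := i) (φ := φ.imp ψ)
    have d₃ := M.val_know_eq_half (s := s) (i := i) (φ := ψ)
    have key : (∀ t ∈ M.K i s, M.val t φ = .one) → (∀ t ∈ M.K i s, M.val t (φ.imp ψ) = .one) →
        ∀ t ∈ M.K i s, M.val t ψ = .one := fun a b t ht => by
      have := b t ht
      rwa [(hh _).imp, a t ht] at this
    have d₄ : M.val s φ ≠ .half → M.val s (φ.imp ψ) ≠ .half → M.val s ψ ≠ .half := by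
      rw [(hh _).imp]
      cases M.val s φ <;> cases M.val s ψ <;> simp [TruthVal.imp]
    apply TruthVal.imp_eq_one
    · intro h
      have : M.val s (.know i φ) = .one ∧ M.val s (.know i (φ.imp ψ)) = .one := by
        revert h
        cases M.val s (.know i φ) <;> cases M.val s (.know i (φ.imp ψ)) <;> simp [TruthVal.and]
      rw [h₁, h₂] at this
      exact h₃.2 ⟨d₄ this.1.1 this.2.1, key this.1.2 this.2.2⟩
    · intro h
      have : M.val s (.know i φ) ≠ .half ∧ M.val s (.know i (φ.imp ψ)) ≠ .half := by
        revert h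
        cases M.val s (.know i φ) <;> cases M.val s (.know i (φ.imp ψ)) <;> simp [TruthVal.and]
      rw [ne_eq, d₁, ne_eq, d₂] at this
      rw [ne_eq, d₃]
      exact d₄ this.1 this.2
  | B1 i φ =>
    rw [(hh _).iff, (hh _).eqHalf, (hh _).eqHalf]
    simp only [val_know_eq_half]
    split_ifs <;> rfl
  | B2 i φ =>
    rw [(hh _).imp]
    apply TruthVal.imp_eq_one
    · rw [(hh _).and, (hh _).or, (hh _).eqZero, (hh _).eqOne, (hh _).eqOne]
      intro h
      have h₁ : M.val s φ ≠ .half := by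
        rintro h'
        revert h
        cases M.val s (.know i φ.eqOne) <;> simp [h', TruthVal.not, TruthVal.and]
      have h₂ : M.val s (.know i φ.eqOne) = .one := by
        revert h
        cases M.val s (.know i φ.eqOne) <;> cases M.val s φ <;> simp [TruthVal.not, TruthVal.and]
      rw [if_pos]
      rw [val_know_eq_one] at h₂ ⊢
      refine ⟨h₁, fun t ht => ?_⟩
      have := h₂.2 t ht
      rw [(hh _).eqOne] at this
      by_contra hne
      simp [hne] at this
    · rw [(hh _).eqOne]; split_ifs <;> simp
  | Conf1 i φ hφ =>
    rw [(hh _).imp]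
    have hd : ∀ t, M.val t φ.eqHalf ≠ .half := fun t => by rw [(hh _).eqHalf]; split_ifs <;> simp
    apply TruthVal.imp_eq_one
    · intro h
      rw [val_know_eq_one]
      refine ⟨hd s, fun t ht => ?_⟩
      rw [(hh _).eqHalf] at h ⊢
      rw [if_pos]
      obtain ⟨Ψ, hs⟩ := M.cover s
      obtain ⟨Ψ', hΨ', hK⟩ := hM.confined i Ψ s hs
      refine val_eq_half_of_isImpFree hs (hK ht) hΨ' φ hφ ?_
      by_contra hne
      simp [hne] at h
    · intro _
      rw [ne_eq, val_know_eq_half]; exact hd s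
  | Conf2 i φ =>
    rw [(hh _).imp]
    have hd : M.val s (φ.or φ.neg).eqOne ≠ .half := by rw [(hh _).eqOne]; split_ifs <;> simp
    apply TruthVal.imp_eq_one
    · intro h
      rw [val_know_eq_one]
      refine ⟨hd, fun t ht => ?_⟩
      rw [(hh _).eqOne, if_pos]
      have : M.val t φ ≠ .half := fun hhalf => by
        have : M.val s (.know i φ.eqHalf) = .one := by
          rw [val_know_eq_one]
          refine ⟨by rw [(hh _).eqHalf]; split_ifs <;> simp, fun t' ht' => ?_⟩
          rw [(hh _).eqHalf, if_pos (hM.val_eq_half_of_mem_K ht ht' hhalf)]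
        rw [(hh _).neg, this] at h
        simp [TruthVal.not] at h
      rw [(hh _).or, (hh _).neg]
      revert this
      cases M.val t φ <;> simp [TruthVal.not, TruthVal.and]
    · intro _
      rw [ne_eq, val_know_eq_half]; exact hd
  | T' h i φ l hl =>
    have hdef : ∀ ψ ∈ l.map fun p => .know i (.eqHalf (.atom p)), M.val s ψ ≠ .half := by
      intro ψ hψ
      obtain ⟨p, -, rfl⟩ := List.mem_map.1 hψ
      rw [ne_eq, val_know_eq_half, (hh _).eqHalf]
      split_ifs <;> simp
    have hd := (hh s).bigOr_ne_half hdef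
    rw [(hh _).imp, (hh _).or]
    apply TruthVal.imp_eq_one
    · intro hk
      rw [val_know_eq_one] at hk
      obtain ⟨Ψ, hs⟩ := M.cover s
      obtain ⟨Ψ', hΨ', hK⟩ := hM.confined i Ψ s hs
      obtain ⟨-, hρ⟩ := subset_of_mem_up hK hs (hM.r h i s)
      -- Either `s` agrees on `φ` with its projection into `K i s`, or some letter of `φ` is lost;
      -- such a letter is undefined throughout `K i s` and makes a disjunct true.
      by_cases hp : ∀ p ∈ φ.atoms, p ∈ Ψ → p ∈ Ψ'
      · have := hM.val_ρ φ hΨ' hp hs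
        rw [hk.2 _ hρ] at this
        rw [← this]
        revert hd
        generalize M.val s (.bigOr _) = a
        cases a <;> simp [TruthVal.not, TruthVal.and]
      · push Not at hp
        obtain ⟨p, hpφ, -, hpΨ'⟩ := hp
        have : M.val s (.bigOr (l.map fun p => .know i (.eqHalf (.atom p)))) = .one := by
          rw [(hh _).bigOr_eq_one hdef]
          refine ⟨_, List.mem_map.2 ⟨p, (hl p).2 hpφ, rfl⟩, ?_⟩
          rw [val_know_eq_one]
          refine ⟨by rw [(hh _).eqHalf]; split_ifs <;> simp, fun t ht => ?_⟩
          rw [(hh _).eqHalf, if_pos]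
          exact not_not.1 ((val_atom_ne_half (hK ht)).not.2 hpΨ')
        rw [this]
        have := hk.1
        revert this
        cases M.val s φ <;> simp [TruthVal.not, TruthVal.and]
    · rw [ne_eq, val_know_eq_half]
      revert hd
      generalize M.val s (.bigOr _) = a
      cases a <;> cases M.val s φ <;> simp [TruthVal.not, TruthVal.and]
  | four' h i φ =>
    rw [(hh _).imp]
    apply TruthVal.imp_eq_one
    · simp only [val_know_eq_one, ne_eq, val_know_eq_half]
      rintro ⟨h₁, h₂⟩
      exact ⟨h₁, fun t ht => ⟨by simp [h₂ t ht], fun t' ht' => h₂ t' (hM.t h i s t ht ht')⟩⟩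
    · simp only [ne_eq, val_know_eq_half, imp_self]
  | five' h i φ =>
    rw [(hh _).imp, (hh _).or]
    have hd : M.val s (.know i φ.eqHalf) ≠ .half := by
      rw [ne_eq, val_know_eq_half, (hh _).eqHalf]; split_ifs <;> simp
    have hdef : M.val s (.neg (.know i (.neg (.know i φ)))) = .half ↔
        M.val s (.know i φ) = .half := by
      have h₁ := M.val_know_eq_half (s := s) (i := i) (φ := .neg (.know i φ))
      rw [(hh _).neg] at h₁ ⊢
      revert h₁
      cases M.val s (.know i (.neg (.know i φ))) <;> cases M.val s (.know i φ) <;>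
        simp [TruthVal.not]
    apply TruthVal.imp_eq_one
    · intro hk
      have h₀ : M.val s (.know i φ) ≠ .half := by rw [ne_eq, ← hdef, hk]; simp
      suffices hor : M.val s (.know i φ) = .one ∨ M.val s (.know i φ.eqHalf) = .one by
        revert hd h₀ hor
        cases M.val s (.know i φ) <;> cases M.val s (.know i φ.eqHalf) <;>
          simp [TruthVal.not, TruthVal.and]
      have h₁ : M.val s (.know i (.neg (.know i φ))) ≠ .one := by
        rw [(hh _).neg] at hk
        rintro h'
        simp [h', TruthVal.not] at hk
      rw [ne_eq, val_know_eq_one] at h₁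
      have h₂ : M.val s (.neg (.know i φ)) ≠ .half := by
        rw [(hh _).neg]
        revert h₀
        cases M.val s (.know i φ) <;> simp [TruthVal.not]
      push Not at h₁
      obtain ⟨t, ht, htk⟩ := h₁ h₂
      -- If `φ` is undefined at `t`, it is undefined throughout `K i s`. Otherwise `K_i φ` is true
      -- at `t`, and `K i s ⊆ K i t` carries it back to `s`.
      by_cases hφ : M.val t φ = .half
      · right
        rw [val_know_eq_one]
        refine ⟨by rw [(hh _).eqHalf]; split_ifs <;> simp, fun t' ht' => ?_⟩
        rw [(hh _).eqHalf, if_pos (hM.val_eq_half_of_mem_K ht ht' hφ)]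
      · left
        have h₃ : M.val t (.know i φ) = .one := by
          rw [← M.val_know_eq_half (i := i)] at hφ
          rw [(hh _).neg] at htk
          revert htk hφ
          cases M.val t (.know i φ) <;> simp [TruthVal.not]
        rw [val_know_eq_one] at h₃ ⊢
        exact ⟨by rwa [ne_eq, ← M.val_know_eq_half (i := i)],
          fun t' ht' => h₃.2 t' (hM.e h i s t ht ht')⟩
    · rw [ne_eq, hdef]
      revert hd
      cases M.val s (.know i φ) <;> cases M.val s (.know i φ.eqHalf) <;>
        simp [TruthVal.not, TruthVal.and]

theorem Provable.val_eq_one {φ : Formula n Φ} (h : Provable C φ) (hM : InClass C M)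
    (s : M.State) : M.val s φ = .one := by
  induction h generalizing s with
  | ax h => exact hM.val_of_isAxiom h s
  | mp _ _ ih₁ ih₂ =>
    have := ih₂ s
    rwa [(M.isHom_val s).imp, ih₁ s] at this
  | gen i _ ih => exact M.val_know_eq_one.2 ⟨by simp [ih s], fun t _ => ih t⟩
  | R1 _ ih =>
    have := ih s
    rw [(M.isHom_val s).eqOne] at this
    by_contra hne
    simp [hne] at this

-- Propositional completeness by skeletons

namespace Formula

/-- The propositional skeleton of a formula: `f` names its propositionally atomic parts. -/
def skeleton (f : Formula n Φ → ℕ) : Formula n Φ → Formula n ℕ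
  | atom p => atom (f (atom p))
  | top => top
  | neg φ => neg (skeleton f φ)
  | and φ ψ => and (skeleton f φ) (skeleton f ψ)
  | imp φ ψ => imp (skeleton f φ) (skeleton f ψ)
  | know i φ => atom (f (know i φ))

/-- The propositionally atomic parts of a formula. -/
def units : Formula n Φ → Set (Formula n Φ)
  | atom p => {atom p}
  | top => ∅
  | neg φ => units φ
  | and φ ψ => units φ ∪ units ψ
  | imp φ ψ => units φ ∪ units ψ
  | know i φ => {know i φ}

theorem finite_units : ∀ φ : Formula n Φ, φ.units.Finite
  | atom _ => Set.finite_singleton _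
  | top => Set.finite_empty
  | neg φ => finite_units φ
  | and φ ψ => (finite_units φ).union (finite_units ψ)
  | imp φ ψ => (finite_units φ).union (finite_units ψ)
  | know _ _ => Set.finite_singleton _

theorem finite_atoms : ∀ φ : Formula n Φ, φ.atoms.Finite
  | atom _ => Set.finite_singleton _
  | top => Set.finite_empty
  | neg φ => finite_atoms φ
  | and φ ψ => (finite_atoms φ).union (finite_atoms ψ)
  | imp φ ψ => (finite_atoms φ).union (finite_atoms ψ)
  | know _ φ => finite_atoms φ

theorem isPropositional_skeleton (f : Formula n Φ → ℕ) :
    ∀ φ : Formula n Φ, (φ.skeleton f).IsPropositional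
  | atom _ => trivial
  | top => trivial
  | neg φ => isPropositional_skeleton f φ
  | and φ ψ => ⟨isPropositional_skeleton f φ, isPropositional_skeleton f ψ⟩
  | imp φ ψ => ⟨isPropositional_skeleton f φ, isPropositional_skeleton f ψ⟩
  | know _ _ => trivial

theorem subst_skeleton {f : Formula n Φ → ℕ} {σ : ℕ → Formula n Φ} :
    ∀ φ : Formula n Φ, (∀ χ ∈ φ.units, σ (f χ) = χ) → (φ.skeleton f).subst σ = φ
  | atom _, h => h _ rfl
  | top, _ => rfl
  | neg φ, h => by rw [skeleton, subst, subst_skeleton φ h]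
  | and φ ψ, h => by
    rw [skeleton, subst, subst_skeleton φ fun χ hχ => h χ (.inl hχ),
      subst_skeleton ψ fun χ hχ => h χ (.inr hχ)]
  | imp φ ψ, h => by
    rw [skeleton, subst, subst_skeleton φ fun χ hχ => h χ (.inl hχ),
      subst_skeleton ψ fun χ hχ => h χ (.inr hχ)]
  | know _ _, h => h _ rfl

@[simp] theorem atoms_eqOne (φ : Formula n Φ) : φ.eqOne.atoms = φ.atoms := by
  simp [eqOne, atoms]

@[simp] theorem atoms_eqHalf (φ : Formula n Φ) : φ.eqHalf.atoms = φ.atoms := by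
  simp [eqHalf, atoms]

end Formula

theorem isHom_skeleton {w : Formula n ℕ → TruthVal} (hw : IsHom w) (f : Formula n Φ → ℕ) :
    IsHom fun φ => w (φ.skeleton f) where
  top := hw.top
  neg _ := hw.neg _
  and _ _ := hw.and _ _
  imp _ _ := hw.imp _ _

/-- Formulas that are true under every homomorphism are provable. -/
theorem Provable.of_forall_isHom {φ : Formula n Φ} (h : ∀ w, IsHom w → w φ = .one) :
    Provable C φ := by
  obtain ⟨f, hf⟩ := Set.countable_iff_exists_injOn.1 φ.finite_units.countable
  have : Nonempty (Formula n Φ) := ⟨.top⟩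
  rw [← φ.subst_skeleton (f := f) (σ := Function.invFunOn f φ.units) fun χ hχ =>
    hf.leftInvOn_invFunOn hχ]
  refine .ax (.prop _ (φ.isPropositional_skeleton f) (fun M _ s => ?_) _)
  rw [← M.val_eq_one]
  exact h _ (isHom_skeleton (M.isHom_val s) f)

-- Theories, worlds and compactness

/-- Sets of formulas that contain the provable formulas and are closed under the propositional
rules. -/
structure IsTheory (C : Set Cond) (T : Set (Formula n Φ)) : Prop where
  provable : ∀ φ, Provable C φ → φ ∈ T
  mp : ∀ φ ψ, φ ∈ T → φ.imp ψ ∈ T → ψ ∈ T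
  R1 : ∀ φ, φ.eqOne ∈ T → φ ∈ T

theorem isTheory_provable : IsTheory C {φ : Formula n Φ | Provable C φ} where
  provable _ h := h
  mp _ _ := .mp
  R1 _ := .R1

theorem IsTheory.of_entails {T : Set (Formula n Φ)} (hT : IsTheory C T) {φ ψ χ : Formula n Φ}
    (hφ : φ ∈ T) (hψ : ψ ∈ T) (h : ∀ w, IsHom w → w φ = .one → w ψ = .one → w χ = .one) :
    χ ∈ T := by
  have one : ∀ {θ}, θ ∈ T → θ.eqOne ∈ T := fun {θ} hθ =>
    hT.mp θ _ hθ <| hT.provable _ <| .of_forall_isHom fun w hw => by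
      rw [hw.imp, hw.eqOne]
      cases w θ <;> rfl
  -- The plain implication φ ↪ (ψ ↪ χ) may be undefined when a premise is false. With φ=1, ψ=1, χ=1,
  -- which are always defined, it is a tautology; R1 then removes the last "=1".
  refine hT.R1 _ (hT.mp _ _ (one hψ) (hT.mp _ _ (one hφ) (hT.provable _ ?_)))
  refine .of_forall_isHom fun w hw => ?_
  have := h w hw
  rw [hw.imp, hw.imp, hw.eqOne, hw.eqOne, hw.eqOne]
  revert this
  cases w φ <;> cases w ψ <;> cases w χ <;> simp [TruthVal.imp]

theorem IsTheory.of_entails_one {T : Set (Formula n Φ)} (hT : IsTheory C T) {φ χ : Formula n Φ}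
    (hφ : φ ∈ T) (h : ∀ w, IsHom w → w φ = .one → w χ = .one) : χ ∈ T :=
  hT.of_entails hφ hφ fun w hw h₁ _ => h w hw h₁

/-- Homomorphisms under which all provable formulas are true. -/
structure World (C : Set Cond) (n : ℕ) (Φ : Type u) where
  val : Formula n Φ → TruthVal
  isHom : IsHom val
  provable : ∀ φ, Provable C φ → val φ = .one

/-- Each defining equation involves finitely many coordinates, so it is a closed condition in the
product topology. -/
theorem isClosed_isHom [TopologicalSpace TruthVal] [DiscreteTopology TruthVal] :
    IsClosed {w : Formula n Φ → TruthVal | IsHom w} := by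
  have : {w : Formula n Φ → TruthVal | IsHom w} =
      {w | w .top = .one} ∩ (⋂ φ, {w | w (.neg φ) = (w φ).not}) ∩
      (⋂ φ, ⋂ ψ, {w | w (.and φ ψ) = (w φ).and (w ψ)}) ∩
      (⋂ φ, ⋂ ψ, {w | w (.imp φ ψ) = (w φ).imp (w ψ)}) := by
    ext w
    simp only [Set.mem_inter_iff, Set.mem_iInter]
    exact ⟨fun h => ⟨⟨⟨h.1, h.2⟩, h.3⟩, h.4⟩, fun h => ⟨h.1.1.1, h.1.1.2, h.1.2, h.2⟩⟩
  rw [this]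
  have c₁ (g : TruthVal → TruthVal) : Continuous g := continuous_of_discreteTopology
  have c₂ (g : TruthVal → TruthVal → TruthVal) (φ ψ : Formula n Φ) :
      Continuous fun w : Formula n Φ → TruthVal => g (w φ) (w ψ) :=
    (continuous_of_discreteTopology (f := fun x : TruthVal × TruthVal => g x.1 x.2)).comp
      (g := fun x => g x.1 x.2) (f := fun w : Formula n Φ → TruthVal => (w φ, w ψ))
      ((continuous_apply φ).prodMk (continuous_apply ψ))
  have h₁ : IsClosed {w : Formula n Φ → TruthVal | w .top = .one} :=
    isClosed_eq (continuous_apply _) continuous_const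
  have h₂ (φ : Formula n Φ) : IsClosed {w : Formula n Φ → TruthVal | w (.neg φ) = (w φ).not} :=
    isClosed_eq (continuous_apply _) ((c₁ TruthVal.not).comp (continuous_apply φ))
  have h₃ (g : TruthVal → TruthVal → TruthVal) (φ ψ χ : Formula n Φ) :
      IsClosed {w : Formula n Φ → TruthVal | w χ = g (w φ) (w ψ)} :=
    isClosed_eq (continuous_apply _) (c₂ g φ ψ)
  exact ((h₁.inter (isClosed_iInter h₂)).inter
    (isClosed_iInter fun φ => isClosed_iInter fun ψ => h₃ .and φ ψ _)).inter
    (isClosed_iInter fun φ => isClosed_iInter fun ψ => h₃ .imp φ ψ _)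

instance : Finite TruthVal :=
  Set.finite_univ_iff.1 <| (Set.toFinite {.zero, .half, .one}).subset fun x _ => by
    cases x <;> simp

/-- A theory that refutes no member of a directed set of formulas has a world in which the whole
set is true. -/
theorem IsTheory.exists_world {T E : Set (Formula n Φ)} (hT : IsTheory C T) (hE : E.Nonempty)
    (hdir : ∀ ε₁ ∈ E, ∀ ε₂ ∈ E, ∃ ε ∈ E, ∀ w, IsHom w → w ε = .one → w ε₁ = .one ∧ w ε₂ = .one)
    (h : ∀ ε ∈ E, ε.eqOne.neg ∉ T) :
    ∃ w : World C n Φ, (∀ ψ ∈ T, w.val ψ = .one) ∧ ∀ ε ∈ E, w.val ε = .one := by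
  let _ : TopologicalSpace TruthVal := ⊥
  have : DiscreteTopology TruthVal := ⟨rfl⟩
  have htop : Formula.top ∈ T := hT.provable _ (.of_forall_isHom fun w hw => hw.top)
  obtain ⟨ε₀, hε₀⟩ := hE
  have : Nonempty (T × E) := ⟨⟨⟨_, htop⟩, ⟨_, hε₀⟩⟩⟩
  -- By directedness it is enough to satisfy one member of `T` and one of `E` at a time; a failure
  -- would make the former entail that the latter is not 1.
  let F : T × E → Set (Formula n Φ → TruthVal) := fun x =>
    {w | IsHom w} ∩ ({w | w x.1 = .one} ∩ {w | w x.2 = .one})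
  have hclosed : ∀ x, IsClosed (F x) := fun x => isClosed_isHom.inter
    ((isClosed_eq (continuous_apply _) continuous_const).inter
      (isClosed_eq (continuous_apply _) continuous_const))
  obtain ⟨w, hw⟩ := IsCompact.nonempty_iInter_of_directed_nonempty_isCompact_isClosed F
    (fun x y => by
      obtain ⟨ε, hε, hdir⟩ := hdir x.2 x.2.2 y.2 y.2.2
      have hand : ∀ w, IsHom w → w (.and (x.1 : Formula n Φ) y.1) = .one →
          w x.1 = .one ∧ w y.1 = .one := fun w hw => by
        rw [hw.and]
        cases w x.1 <;> cases w y.1 <;> simp [TruthVal.and]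
      refine ⟨⟨⟨.and x.1 y.1, hT.of_entails x.1.2 y.1.2 fun w hw h₁ h₂ => ?_⟩, ⟨ε, hε⟩⟩, ?_, ?_⟩
      · rw [hw.and, h₁, h₂]; rfl
      · exact fun w hw => ⟨hw.1, (hand w hw.1 hw.2.1).1, (hdir w hw.1 hw.2.2).1⟩
      · exact fun w hw => ⟨hw.1, (hand w hw.1 hw.2.1).2, (hdir w hw.1 hw.2.2).2⟩)
    (fun x => by
      by_contra hne
      refine h x.2 x.2.2 (hT.of_entails_one x.1.2 fun w hw h₁ => ?_)
      have h₂ : w x.2 ≠ .one := fun h₂ => hne ⟨w, hw, h₁, h₂⟩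
      rw [hw.neg, hw.eqOne, if_neg h₂]
      rfl)
    (fun x => (hclosed x).isCompact) hclosed
  rw [Set.mem_iInter] at hw
  have hψ : ∀ ψ ∈ T, w ψ = .one := fun ψ hψ => (hw ⟨⟨ψ, hψ⟩, ⟨ε₀, hε₀⟩⟩).2.1
  exact ⟨⟨w, (hw ⟨⟨_, htop⟩, ⟨ε₀, hε₀⟩⟩).1, fun φ hφ => hψ φ (hT.provable φ hφ)⟩, hψ,
    fun ε hε => (hw ⟨⟨_, htop⟩, ⟨ε, hε⟩⟩).2.2⟩

theorem IsTheory.exists_world_ne_one {T : Set (Formula n Φ)} (hT : IsTheory C T)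
    {φ : Formula n Φ} (h : φ ∉ T) :
    ∃ w : World C n Φ, (∀ ψ ∈ T, w.val ψ = .one) ∧ w.val φ ≠ .one := by
  obtain ⟨w, hw, hφ⟩ := hT.exists_world (E := {φ.eqOne.neg}) ⟨_, rfl⟩
    (by rintro _ rfl _ rfl; exact ⟨_, rfl, fun _ _ h => ⟨h, h⟩⟩) (by
      rintro _ rfl h'
      refine h (hT.of_entails_one h' fun w hw => ?_)
      rw [hw.neg, hw.eqOne, hw.neg, hw.eqOne]
      cases w φ <;> simp [TruthVal.not])
  refine ⟨w, hw, fun h' => ?_⟩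
  have := hφ _ rfl
  rw [w.isHom.neg, w.isHom.eqOne, if_pos h'] at this
  simp [TruthVal.not] at this

-- Canonical accessibility, awareness and extension

namespace World

variable (w : World C n Φ) (i : Fin n)

/-- If an implication is provable and its premise is true then so is its conclusion. -/
theorem mp {w : World C n Φ} {φ ψ : Formula n Φ} (h : Provable C (φ.imp ψ))
    (hφ : w.val φ = .one) : w.val ψ = .one := by
  have := w.provable _ h
  rwa [w.isHom.imp, hφ] at this

theorem val_know_eq_half (φ : Formula n Φ) :
    w.val (.know i φ) = .half ↔ w.val φ = .half := by
  have := w.provable _ (.ax (.B1 i φ))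
  rw [w.isHom.iff, w.isHom.eqHalf, w.isHom.eqHalf] at this
  revert this
  cases w.val φ <;> cases w.val (.know i φ) <;> simp [TruthVal.imp, TruthVal.and]

theorem eqOne_eq_one {φ : Formula n Φ} : w.val φ.eqOne = .one ↔ w.val φ = .one := by
  rw [w.isHom.eqOne]; split_ifs <;> simp [*]

theorem eqHalf_eq_one {φ : Formula n Φ} : w.val φ.eqHalf = .one ↔ w.val φ = .half := by
  rw [w.isHom.eqHalf]; split_ifs <;> simp [*]

theorem eqOne_ne_half (φ : Formula n Φ) : w.val φ.eqOne ≠ .half := by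
  rw [w.isHom.eqOne]; split_ifs <;> simp

theorem eqHalf_ne_half (φ : Formula n Φ) : w.val φ.eqHalf ≠ .half := by
  rw [w.isHom.eqHalf]; split_ifs <;> simp

theorem neg_eq_one {φ : Formula n Φ} : w.val φ.neg = .one ↔ w.val φ = .zero := by
  rw [w.isHom.neg]; cases w.val φ <;> simp [TruthVal.not]

theorem neg_eqOne_eq_one {φ : Formula n Φ} : w.val φ.eqOne.neg = .one ↔ w.val φ ≠ .one := by
  rw [w.neg_eq_one, w.isHom.eqOne]; split_ifs <;> simp [*]

theorem eq_zero_iff {φ : Formula n Φ} (h : w.val φ ≠ .half) :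
    w.val φ = .zero ↔ w.val φ ≠ .one := by
  revert h; cases w.val φ <;> simp

theorem know_mp {w : World C n Φ} {i : Fin n} {φ ψ : Formula n Φ}
    (h : w.val (.know i (φ.imp ψ)) = .one) (hφ : w.val (.know i φ) = .one) :
    w.val (.know i ψ) = .one := by
  refine mp (.ax (.K' i φ ψ)) ?_
  rw [w.isHom.and, h, hφ]
  rfl

theorem know_of_entails {w : World C n Φ} {i : Fin n} {φ ψ χ : Formula n Φ}
    (hφ : w.val (.know i φ) = .one) (hψ : w.val (.know i ψ) = .one)
    (h : ∀ w, IsHom w → w (φ.imp (ψ.imp χ)) = .one) : w.val (.know i χ) = .one :=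
  know_mp (know_mp (w.provable _ (.gen i (.of_forall_isHom h))) hφ) hψ

/-- The formulas that the agent knows to be true. -/
def known : Set (Formula n Φ) := {φ | w.val (.know i φ.eqOne) = .one}

theorem mem_known {w : World C n Φ} {i : Fin n} {φ : Formula n Φ} :
    φ ∈ w.known i ↔ w.val (.know i φ.eqOne) = .one := Iff.rfl

theorem isTheory_known : IsTheory C (w.known i) where
  provable φ h := w.provable _ <| .gen i <| isTheory_provable.of_entails_one h fun w hw h => by
    rw [hw.eqOne, if_pos h]
  mp φ ψ h₁ h₂ := know_of_entails h₁ h₂ fun w hw => by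
    rw [hw.imp, hw.imp, hw.eqOne, hw.eqOne, hw.eqOne, hw.imp]
    cases w φ <;> cases w ψ <;> simp [TruthVal.imp]
  R1 φ h := know_of_entails h h fun w hw => by
    rw [hw.imp, hw.imp, hw.eqOne, hw.eqOne]
    cases w φ <;> simp [TruthVal.imp]

/-- B2 gives the forward direction. Definedness is needed there, since K_i(φ=1) can be true while
K_i φ is undefined. -/
theorem mem_known_iff {w : World C n Φ} {i : Fin n} {φ : Formula n Φ} (h : w.val φ ≠ .half) :
    φ ∈ w.known i ↔ w.val (.know i φ) = .one := by
  constructor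
  · intro hk
    rw [mem_known] at hk
    rw [← eqOne_eq_one]
    refine mp (.ax (.B2 i φ)) ?_
    rw [w.isHom.and, hk, w.isHom.or, w.isHom.eqZero, w.isHom.eqOne]
    revert h
    cases w.val φ <;> simp [TruthVal.not, TruthVal.and]
  · intro hk
    refine know_of_entails hk hk fun w hw => ?_
    rw [hw.imp, hw.imp, hw.eqOne]
    cases w φ <;> simp [TruthVal.imp]

/-- The canonical accessibility relation. -/
def Acc (w : World C n Φ) (i : Fin n) (v : World C n Φ) : Prop := ∀ φ ∈ w.known i, v.val φ = .one

/-- The letters that are defined in a world. -/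
def dom : Set Φ := {p | w.val (.atom p) ≠ .half}

/-- The letters that the agent is aware of. -/
def aware : Set Φ := {p | w.val (.know i (.eqHalf (.atom p))) ≠ .one}

/-- `x` gives the same truth values as `v` to the formulas in the vocabulary of `v`. -/
def Extends (v x : World C n Φ) : Prop :=
  ∀ φ : Formula n Φ, φ.atoms ⊆ v.dom → x.val φ = v.val φ

variable {w i} {v x y : World C n Φ}

theorem aware_subset_dom : w.aware i ⊆ w.dom := fun p hp => by
  contrapose! hp
  have : w.val (.atom p) = .half := not_not.1 hp
  exact not_not.2 (mp (.ax (.Conf1 i (.atom p) trivial)) (w.eqHalf_eq_one.2 this))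

/-- By Conf2 the agent either knows p=½ or knows that p is defined, so all accessible worlds settle
the definedness of p alike. -/
theorem Acc.dom_eq (h : w.Acc i v) : v.dom = w.aware i := by
  ext p
  by_cases hp : w.val (.know i (.eqHalf (.atom p))) = .one
  · rw [← mem_known_iff (w.eqHalf_ne_half _)] at hp
    have h₁ := v.eqHalf_eq_one.1 (h _ hp)
    rw [mem_known_iff (w.eqHalf_ne_half _)] at hp
    exact iff_of_false (not_not.2 h₁) (not_not.2 hp)
  · refine iff_of_true (fun h' => ?_) hp
    have hz : w.val (.know i (.eqHalf (.atom p))) = .zero :=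
      (w.eq_zero_iff (by rw [ne_eq, val_know_eq_half]; exact w.eqHalf_ne_half _)).2 hp
    have := h _ (mp (.ax (.Conf2 i (.atom p))) (w.neg_eq_one.2 hz))
    rw [v.isHom.or, v.isHom.neg, h'] at this
    simp [TruthVal.not, TruthVal.and] at this

theorem Extends.refl : Extends w w := fun _ _ => rfl

theorem Extends.dom_subset (h : Extends v x) : v.dom ⊆ x.dom := fun p hp => by
  have := h (.atom p) (by simpa [Formula.atoms] using hp)
  exact fun h' => hp (this ▸ h')

theorem Extends.trans (h₁ : Extends w v) (h₂ : Extends v x) : Extends w x := fun φ hφ =>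
  (h₂ φ (hφ.trans h₁.dom_subset)).trans (h₁ φ hφ)

/-- If `x` satisfies everything over the vocabulary `Ψ` that is known at `w`, then some
accessible world agrees with `x` on the formulas over `Ψ`. -/
theorem exists_acc_agree {Ψ : Set Φ}
    (h : ∀ φ : Formula n Φ, φ.atoms ⊆ Ψ → φ ∈ w.known i → x.val φ = .one) :
    ∃ v, w.Acc i v ∧ ∀ φ : Formula n Φ, φ.atoms ⊆ Ψ → v.val φ = x.val φ := by
  obtain ⟨v, hv, hE⟩ := (w.isTheory_known i).exists_world
    (E := {φ | φ.atoms ⊆ Ψ ∧ x.val φ = .one}) ⟨.top, Set.empty_subset _, x.isHom.top⟩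
    (by
      rintro ε₁ ⟨hs₁, h₁⟩ ε₂ ⟨hs₂, h₂⟩
      refine ⟨.and ε₁ ε₂, ⟨Set.union_subset hs₁ hs₂, ?_⟩, fun u hu => ?_⟩
      · rw [x.isHom.and, h₁, h₂]; rfl
      · rw [hu.and]
        cases u ε₁ <;> cases u ε₂ <;> simp [TruthVal.and])
    (by
      rintro ε ⟨hs, hε⟩ hk
      exact x.neg_eqOne_eq_one.1 (h _ (by simpa [Formula.atoms] using hs) hk) hε)
  refine ⟨v, hv, fun φ hφ => ?_⟩
  -- Each of the three values of `φ` at `x` is expressed by the truth of a formula over the same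
  -- letters: `φ`, ¬φ or φ=½.
  cases hx : x.val φ with
  | one => exact hE φ ⟨hφ, hx⟩
  | zero => exact v.neg_eq_one.1 (hE φ.neg ⟨hφ, x.neg_eq_one.2 hx⟩)
  | half => exact v.eqHalf_eq_one.1 (hE φ.eqHalf ⟨by simpa using hφ, x.eqHalf_eq_one.2 hx⟩)

theorem Extends.mem_known_iff (h : Extends w y) {φ : Formula n Φ} (hφ : φ.atoms ⊆ w.dom) :
    φ ∈ y.known i ↔ φ ∈ w.known i := by
  rw [mem_known, mem_known, h _ (by simpa [Formula.atoms] using hφ)]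

theorem Extends.mem_aware_iff (h : Extends w y) {p : Φ} (hp : p ∈ w.dom) :
    p ∈ y.aware i ↔ p ∈ w.aware i :=
  not_congr (by rw [h _ (by simpa [Formula.atoms] using hp)])

theorem Extends.aware_eq (h : Extends w y) : w.aware i = w.dom ∩ y.aware i := by
  ext p
  constructor
  · exact fun hp => ⟨aware_subset_dom hp, (h.mem_aware_iff (aware_subset_dom hp)).2 hp⟩
  · exact fun hp => (h.mem_aware_iff hp.1).1 hp.2

/-- What `w` knows over the letters in `w.aware i` is also known at `y`, hence true at `x`;
`exists_acc_agree` then applies. -/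
theorem Extends.exists_acc_restrict (h : Extends w y) (hx : y.Acc i x) :
    ∃ v, w.Acc i v ∧ Extends v x := by
  obtain ⟨v, hv, ha⟩ := exists_acc_agree (w := w) (i := i) (x := x) (Ψ := w.aware i)
    fun φ hφ hk => hx φ ((h.mem_known_iff (hφ.trans aware_subset_dom)).2 hk)
  exact ⟨v, hv, fun φ hφ => (ha φ (hv.dom_eq ▸ hφ)).symm⟩

theorem Extends.exists_acc_extend (h : Extends w y) (hv : w.Acc i v) :
    ∃ x, y.Acc i x ∧ Extends v x := by
  obtain ⟨x, hx, ha⟩ := exists_acc_agree (w := y) (i := i) (x := v) (Ψ := v.dom)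
    fun φ hφ hk => hv φ ((h.mem_known_iff (hφ.trans (hv.dom_eq ▸ aware_subset_dom))).1 hk)
  exact ⟨x, hx, ha⟩

variable (w i) in
/-- The information sets of the canonical awareness structure. -/
def info : Set (World C n Φ) := {x | x.aware i ⊆ w.aware i ∧ ∃ v, w.Acc i v ∧ Extends v x}

theorem Acc.mem_info (h : w.Acc i v) : v ∈ w.info i :=
  ⟨aware_subset_dom.trans h.dom_eq.subset, v, h, .refl⟩

/-- Over letters of which the agent is aware, every disjunct K_i(p=½) in T′ fails, so T′ for φ=1
makes known formulas true at `w`. -/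
theorem mem_info_self (hr : Cond.r ∈ C) : w ∈ w.info i := by
  refine ⟨subset_rfl, ?_⟩
  suffices h : ∀ φ : Formula n Φ, φ.atoms ⊆ w.aware i → φ ∈ w.known i → w.val φ = .one by
    obtain ⟨v, hv, ha⟩ := exists_acc_agree h
    exact ⟨v, hv, fun φ hφ => (ha φ (hv.dom_eq ▸ hφ)).symm⟩
  intro φ hφ hk
  have hl : ∀ p, p ∈ φ.finite_atoms.toFinset.toList ↔ p ∈ φ.eqOne.atoms := by simp
  have h₁ := mp (.ax (.T' hr i φ.eqOne _ hl)) hk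
  have hdef : ∀ ψ ∈ φ.finite_atoms.toFinset.toList.map
      fun p => .know i (.eqHalf (.atom p)), w.val ψ ≠ .half := by
    intro ψ hψ
    obtain ⟨p, -, rfl⟩ := List.mem_map.1 hψ
    rw [ne_eq, val_know_eq_half]
    exact w.eqHalf_ne_half _
  have h₂ : w.val (.bigOr (φ.finite_atoms.toFinset.toList.map
      fun p => .know i (.eqHalf (.atom p)))) ≠ .one := by
    rw [ne_eq, w.isHom.bigOr_eq_one hdef]
    rintro ⟨ψ, hψ, h'⟩
    obtain ⟨p, hp, rfl⟩ := List.mem_map.1 hψ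
    exact hφ (by simpa using hp) h'
  rw [← eqOne_eq_one]
  rw [w.isHom.or] at h₁
  revert h₁ h₂
  generalize w.val (.bigOr _) = a
  cases a <;> cases w.val φ.eqOne <;> simp [TruthVal.not, TruthVal.and]

theorem Acc.trans (ht : Cond.t ∈ C) (h₁ : w.Acc i v) (h₂ : v.Acc i x) : w.Acc i x := fun φ hφ =>
  h₂ φ (h₁ _ ((World.mem_known_iff (by
    rw [ne_eq, val_know_eq_half]; exact w.eqOne_ne_half φ)).2 (mp (.ax (.four' ht i _)) hφ)))

theorem info_subset (ht : Cond.t ∈ C) (hx : x ∈ w.info i) : x.info i ⊆ w.info i := by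
  rintro y ⟨hy, y₀, hy₀, hyy⟩
  obtain ⟨hx, x₀, hx₀, hxx⟩ := hx
  obtain ⟨y₁, hy₁, hyy₁⟩ := hxx.exists_acc_restrict hy₀
  exact ⟨hy.trans hx, y₁, hx₀.trans ht hy₁, hyy₁.trans hyy⟩

/-- A world with no accessible world knows every p=½ and is aware of nothing, hence the witness `y`.
By transitivity a world two steps away is also one step away, so its domain is computed in two ways.
-/
theorem aware_subset_of_info_nonempty (ht : Cond.t ∈ C) (hx : x ∈ w.info i)
    (hy : y ∈ x.info i) : w.aware i ⊆ x.aware i := by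
  obtain ⟨-, x₀, hx₀, hxx⟩ := hx
  obtain ⟨-, y₀, hy₀, -⟩ := hy
  obtain ⟨y₁, hy₁, -⟩ := hxx.exists_acc_restrict hy₀
  rw [← (hx₀.trans ht hy₁).dom_eq, hy₁.dom_eq, hxx.aware_eq]
  exact Set.inter_subset_right

/-- For an always defined formula, the disjunct K_i(φ=½) of 5′ would contradict definedness at `v`,
so 5′ acts as the Euclidean axiom. It is applied to formulas φ=1 and p=½. -/
theorem Acc.known_subset (he : Cond.e ∈ C) (h : w.Acc i v) {φ : Formula n Φ}
    (hd : ∀ w : World C n Φ, w.val φ ≠ .half) (hk : v.val (.know i φ) = .one) :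
    w.val (.know i φ) = .one := by
  have hd' : ∀ w : World C n Φ, w.val (.know i φ) ≠ .half := fun w => by
    rw [ne_eq, val_know_eq_half]; exact hd w
  have hdn : w.val (.neg (.know i φ)) ≠ .half := by
    have := hd' w
    rw [w.isHom.neg]
    revert this
    cases w.val (.know i φ) <;> simp [TruthVal.not]
  have h₁ : w.val (.neg (.know i (.neg (.know i φ)))) = .one := by
    rw [neg_eq_one, eq_zero_iff _ (by rwa [ne_eq, val_know_eq_half]),
      ne_eq, ← World.mem_known_iff hdn]
    intro hk'
    have := h _ hk'
    rw [neg_eq_one, hk] at this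
    simp at this
  have h₂ := mp (.ax (.five' he i φ)) h₁
  have h₃ : w.val (.know i φ.eqHalf) ≠ .one := by
    rw [ne_eq, ← World.mem_known_iff (w.eqHalf_ne_half _)]
    exact fun hk' => hd v (v.eqHalf_eq_one.1 (h _ hk'))
  rw [w.isHom.or] at h₂
  revert h₂ h₃
  cases w.val (.know i φ) <;> cases w.val (.know i φ.eqHalf) <;>
    simp [TruthVal.not, TruthVal.and]

theorem aware_subset_of_mem_info (he : Cond.e ∈ C) (hx : x ∈ w.info i) :
    w.aware i ⊆ x.aware i := by
  obtain ⟨-, x₀, hx₀, hxx⟩ := hx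
  intro p hp
  rw [hxx.mem_aware_iff (hx₀.dom_eq ▸ hp)]
  exact fun hk => hp (hx₀.known_subset he (fun w => w.eqHalf_ne_half _) hk)

theorem subset_info (he : Cond.e ∈ C) (hx : x ∈ w.info i) : w.info i ⊆ x.info i := by
  have hwx := aware_subset_of_mem_info he hx
  obtain ⟨hxw, x₀, hx₀, hxx⟩ := hx
  rintro y ⟨hyw, y₀, hy₀, hyy⟩
  obtain ⟨z, hz, hyz⟩ := hxx.exists_acc_extend (v := y₀) (i := i)
    fun φ hφ => hy₀ φ (hx₀.known_subset he (fun w => w.eqOne_ne_half _) hφ)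
  refine ⟨hyw.trans hwx, z, hz, fun φ hφ => ?_⟩
  -- The awareness bound in `info` enters here: `z` has domain `x.aware i ⊆ w.aware i = y₀.dom`, so
  -- `y` and `z` agree over it through `y₀`.
  have hφ' : φ.atoms ⊆ y₀.dom := by
    rw [hy₀.dom_eq]
    exact hφ.trans (hz.dom_eq.subset.trans hxw)
  rw [hyy φ hφ', hyz φ hφ']

end World

-- Canonical structure and truth lemma

open Classical in
/-- The canonical HMS structure: a state is a world with a vocabulary. -/
noncomputable abbrev canonical (C : Set Cond) (n : ℕ) (Φ : Type u) : Structure.{u, u} n Φ where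
  State := World C n Φ × Set Φ
  S Ψ := {s | s.2 = Ψ}
  cover s := ⟨s.2, rfl⟩
  K i s := {t | t.1 ∈ s.1.info i ∧ t.2 = s.2 ∩ s.1.aware i}
  -- The vocabulary may contain letters undefined in the world; these are made false by convention.
  -- The truth lemma never meets them.
  π s p := if p ∈ s.2 then (if s.1.val (.atom p) = .one then .one else .zero) else .half
  π_defined := by
    rintro _ s rfl p
    split_ifs <;> simp [*]
  ρ _ Ψ s := (s.1, Ψ)
  ρ_mapsTo _ _ _ _ _ := rfl
  ρ_surjOn := by
    rintro _ Ψ' - s rfl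
    exact ⟨(s.1, Ψ'), rfl, rfl⟩
  ρ_comp _ _ _ _ _ _ _ := rfl
  ρ_π := by
    rintro Ψ _ h s rfl p hp
    simp [hp, h hp]

theorem mem_up_canonical {i : Fin n} {s t : (canonical C n Φ).State} :
    t ∈ (canonical C n Φ).up ((canonical C n Φ).K i s) ↔
      t.1 ∈ s.1.info i ∧ s.2 ∩ s.1.aware i ⊆ t.2 := by
  constructor
  · rintro ⟨Ψ, _, -, hΨ, rfl, h₁, h₂⟩
    exact ⟨h₁, h₂ ▸ hΨ⟩
  · exact fun h => ⟨s.2 ∩ s.1.aware i, t.2, fun _ h => h.2, h.2, rfl, h.1, rfl⟩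

theorem inClass_canonical : InClass C (canonical C n Φ) where
  confined i := by
    rintro _ s rfl
    exact ⟨s.2 ∩ s.1.aware i, Set.inter_subset_left, fun t ht => ht.2⟩
  knowledge i Ψ₁ Ψ₂ Ψ₃ h₁ h₂ s hs hK := by
    obtain rfl : s.2 = Ψ₃ := hs
    ext t
    constructor
    · rintro ⟨x, hx, rfl⟩
      refine ⟨hx.1, (Set.inter_eq_left.2 fun p hp => ?_).symm⟩
      have h' : p ∈ x.2 := (hK hx : x.2 = Ψ₂) ▸ h₁ hp
      rw [hx.2] at h'
      exact h'.2
    · rintro ⟨ht₁, ht₂⟩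
      have hx : ((t.1, s.2 ∩ s.1.aware i) : (canonical C n Φ).State) ∈
        (canonical C n Φ).K i s := ⟨ht₁, rfl⟩
      have hΨ : s.2 ∩ s.1.aware i = Ψ₂ := hK hx
      refine ⟨_, hx, Prod.ext rfl ?_⟩
      rw [ht₂]
      exact (Set.inter_eq_left.2 fun p hp => (hΨ.symm ▸ h₁ hp : p ∈ s.2 ∩ _).2).symm
  ignorance i Ψ Ψ' h s hs t ht := by
    obtain rfl : s.2 = Ψ' := hs
    rw [mem_up_canonical] at ht ⊢
    exact ⟨ht.1, (Set.inter_subset_inter_left _ h).trans ht.2⟩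
  r hr i s := mem_up_canonical.2 ⟨World.mem_info_self hr, Set.inter_subset_left⟩
  t ht i s := by
    rintro x ⟨hx, hx₂⟩ y ⟨hy, hy₂⟩
    refine ⟨World.info_subset ht hx hy, ?_⟩
    rw [hy₂, hx₂, Set.inter_eq_left]
    exact Set.inter_subset_right.trans (World.aware_subset_of_info_nonempty ht hx hy)
  e he i s := by
    rintro x ⟨hx, hx₂⟩ y ⟨hy, hy₂⟩
    refine ⟨World.subset_info he hx hy, ?_⟩
    rw [hy₂, hx₂, Set.left_eq_inter]
    exact Set.inter_subset_right.trans (World.aware_subset_of_mem_info he hx)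

/-- At a state over the vocabulary of a world `v`, truth is given by `v`. -/
theorem canonical_val (φ : Formula n Φ) : ∀ {v x : World C n Φ}, v.Extends x →
    (canonical C n Φ).val ((x, v.dom) : World C n Φ × Set Φ) φ = v.val φ := by
  have hh := (canonical C n Φ).isHom_val
  induction φ with
  | atom p =>
    intro v x h
    rw [Structure.val_atom]
    by_cases hp : p ∈ v.dom
    · have hp' : v.val (.atom p) ≠ .half := hp
      have hx := h (.atom p) (by simpa [Formula.atoms] using hp)
      simp only [hp, if_true, hx]
      revert hp'
      cases v.val (.atom p) <;> simp
    · have hp' : v.val (.atom p) = .half := not_not.1 hp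
      simp [hp, hp']
  | top => intro v x _; rw [(hh _).top, v.isHom.top]
  | neg φ ih => intro v x h; rw [(hh _).neg, v.isHom.neg, ih h]
  | and φ ψ ih₁ ih₂ => intro v x h; rw [(hh _).and, v.isHom.and, ih₁ h, ih₂ h]
  | imp φ ψ ih₁ ih₂ => intro v x h; rw [(hh _).imp, v.isHom.imp, ih₁ h, ih₂ h]
  | know i φ ih =>
    intro v x h
    have h₁ := (canonical C n Φ).val_know_eq_half (s := (x, v.dom)) (i := i) (φ := φ)
    have h₂ := (canonical C n Φ).val_know_eq_one (s := (x, v.dom)) (i := i) (φ := φ)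
    rw [ih h, ← v.val_know_eq_half i] at h₁
    rw [ih h] at h₂
    have h₃ : (canonical C n Φ).val (x, v.dom) (.know i φ) = .one ↔
        v.val (.know i φ) = .one := by
      rw [h₂]
      constructor
      · rintro ⟨hd, hk⟩
        rw [← World.mem_known_iff hd]
        by_contra hne
        obtain ⟨u, hu, huφ⟩ := (v.isTheory_known i).exists_world_ne_one hne
        -- The counterexample `u` is accessible from `v`, but the information set is computed from
        -- `x`, so `u` is lifted to a world accessible from `x`.
        obtain ⟨y, hy, huy⟩ := h.exists_acc_extend (v := u) hu
        have := hk (y, u.dom) ⟨hy.mem_info, by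
          rw [World.Acc.dom_eq (w := v) (i := i) hu]; exact h.aware_eq⟩
        rw [ih huy] at this
        exact huφ this
      · intro hk
        have hd : v.val φ ≠ .half := by rw [ne_eq, ← v.val_know_eq_half i, hk]; simp
        refine ⟨hd, ?_⟩
        rintro ⟨y, Ψ⟩ ⟨⟨-, y₀, hy₀, hyy⟩, hΨ⟩
        -- Conversely, `y₀` is restricted to a world `u` accessible from `v`, whose domain is the
        -- vocabulary of the given state.
        obtain ⟨u, hu, huy⟩ := h.exists_acc_restrict hy₀
        obtain rfl : Ψ = u.dom := by rw [hu.dom_eq, h.aware_eq]; exact hΨ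
        rw [ih (huy.trans hyy)]
        exact hu φ ((World.mem_known_iff hd).2 hk)
    revert h₁ h₃
    cases (canonical C n Φ).val (x, v.dom) (.know i φ) <;> cases v.val (.know i φ) <;> simp

theorem StronglyValid.provable {φ : Formula n Φ} (h : StronglyValid C φ) : Provable C φ := by
  by_contra hφ
  obtain ⟨w, -, hw⟩ := isTheory_provable.exists_world_ne_one hφ
  have := (canonical C n Φ).val_eq_one.2 (h _ inClass_canonical (w, w.dom))
  rw [canonical_val φ World.Extends.refl] at this
  exact hw this

end HMS

theorem mainTheorem1 {Φ : Type*} (n : ℕ) (C : Set HMS.Cond) :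
    (∀ φ : HMS.Formula n Φ, HMS.Provable C φ → HMS.StronglyValid C φ) ∧
    (∀ φ : HMS.Formula n Φ, HMS.StronglyValid C φ → HMS.Provable C φ) :=
  ⟨fun _ h M hM s => M.val_eq_one.1 (h.val_eq_one hM s), fun _ h => h.provable⟩
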